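/- Let $N, d \in \mathbb{N}_0$ and let $\mathcal{S}$ be a family of subsets of $\{1,\dots,N\}$. For $S \subset \{1,\dots,N\}$ let $\chi_S(x) = \prod_{k \in S} x_k$, $x \in \{-1,+1\}^N$, be the Walsh function of $S$, and for $f\colon \{-1,+1\}^N \to \mathbb{R}$ put $\widehat{f}(S) = 2^{-N}\sum_{x \in \{-1,+1\}^N} f(x)\chi_S(x)$. Let $\mathcal{B}^N_{\mathcal{S}}$ be the real Banach space of all functions $f\colon \{-1,+1\}^N \to \mathbb{R}$ such that $\widehat{f}(S) \neq 0$ only if $S \in \mathcal{S}$, with the supremum norm. For a real Banach space $X$ let $$\boldsymbol{\lambda}(X) = \sup_{Z,\, I}\ \inf\big\{\|P\| : P\colon Z \to I(X) \text{ bounded linear},\ P|_{I(X)} = \mathrm{id}_{I(X)}\big\}$$ be its (absolute) projection constant, where the supremum is over all real Banach spaces $Z$ and all linear isometric embeddings $I\colon X \to Z$. If $|S| = d$ for all $S \in \mathcal{S}$, then $$\frac{1}{e^{d/2}}\sqrt{|\mathcal{S}|} \le \boldsymbol{\lambda}\big(\mathcal{B}^N_{\mathcal{S}}\big) \le \sqrt{|\mathcal{S}|},$$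 and if $|S| \le d$ for all $S \in \mathcal{S}$, then $$\frac{1}{(2.69076)^d}\sqrt{|\mathcal{S}|} \le \boldsymbol{\lambda}\big(\mathcal{B}^N_{\mathcal{S}}\big) \le \sqrt{|\mathcal{S}|}.$$ -/

import Mathlib

open scoped ENNReal

universe w

noncomputable section

namespace BooleanProj

/-- The Boolean cube `{-1, +1}^N`; the two signs are the units of `ℤ`. -/
abbrev Cube (N : ℕ) : Type := Fin N → ℤˣ

/-- The Walsh function `χ_S(x) = x^S = ∏_{k ∈ S} x_k`. -/
def walsh {N : ℕ} (S : Finset (Fin N)) (x : Cube N) : ℝ :=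
  ∏ k ∈ S, (((x k : ℤˣ) : ℤ) : ℝ)

/-- The Fourier coefficient `f^(S) = 𝔼[f χ_S]` with respect to the uniform probability measure. -/
def walshCoeff {N : ℕ} (f : Cube N → ℝ) (S : Finset (Fin N)) : ℝ :=
  (1 / (2 : ℝ) ^ N) * ∑ x : Cube N, f x * walsh S x

/-- The space of all real functions on the cube whose Fourier--Walsh expansion is supported on the
family `F`. It carries the norm of the ambient space `Cube N → ℝ`, which is the supremum norm. -/
def walshSpace {N : ℕ} (F : Finset (Finset (Fin N))) : Submodule ℝ (Cube N → ℝ) where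
  carrier := {f | ∀ S : Finset (Fin N), walshCoeff f S ≠ 0 → S ∈ F}
  zero_mem' := by
    intro S h
    exact absurd (by simp [walshCoeff]) h
  add_mem' := by
    intro f g hf hg S h
    by_contra hS
    have h1 : walshCoeff f S = 0 := by
      by_contra h1
      exact hS (hf S h1)
    have h2 : walshCoeff g S = 0 := by
      by_contra h2
      exact hS (hg S h2)
    apply h
    have h3 : walshCoeff (f + g) S = walshCoeff f S + walshCoeff g S := by
      simp [walshCoeff, add_mul, Finset.sum_add_distrib, mul_add]
    rw [h3, h1, h2, add_zero]
  smul_mem' := by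
    intro c f hf S h
    apply hf S
    intro h1
    apply h
    have h3 : walshCoeff (c • f) S = c * walshCoeff f S := by
      simp only [walshCoeff, Pi.smul_apply, smul_eq_mul, Finset.mul_sum]
      exact Finset.sum_congr rfl fun x _ => by ring
    rw [h3, h1, mul_zero]

/-- The relative projection constant `λ(X, Y) = inf ‖P‖` over all bounded linear projections `P`
of `Y` onto its subspace `X`; it is `∞` if there is no such projection. -/
def relProjConst {Y : Type*} [NormedAddCommGroup Y] [NormedSpace ℝ Y] (X : Submodule ℝ Y) :
    ℝ≥0∞ :=
  ⨅ (P : Y →L[ℝ] X) (_ : ∀ x : X, P (x : Y) = x), ENNReal.ofReal ‖P‖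

/-- The (absolute) projection constant `λ(X) = sup λ(I(X), Z)`, the supremum being taken over all
real Banach spaces `Z` (in the universe `v`) and all linear isometric embeddings `I : X → Z`. -/
def projConst.{v, u} (X : Type u) [NormedAddCommGroup X] [NormedSpace ℝ X] : ℝ≥0∞ :=
  ⨆ (Z : Type v) (_ : NormedAddCommGroup Z) (_ : NormedSpace ℝ Z) (_ : CompleteSpace Z)
    (I : X →ₗᵢ[ℝ] Z), relProjConst (LinearMap.range I.toLinearMap)

end BooleanProj

end

/-!
The projection constant of `walshSpace F` is compared with the mean of `|f|`, where
`f = ∑_{S ∈ F} χ_S`.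

*Upper bound.* The orthogonal projection onto `walshSpace F` is convolution with `f`, so its norm
for the supremum norm is at most the `L¹` norm of `f`, hence at most its `L²` norm `√|F|`
(`norm_walshProj_le`). Since the target is a finite-dimensional `ℓ^∞`, the Hahn–Banach theorem
extends the inverse of any isometric embedding coordinate by coordinate, without increase of the
norm, and this transports the projection to every ambient space (`projConst_walshSpace_le`).

*Lower bound.* Averaging an arbitrary projection of `ℓ^∞` of the cube over the translations of the
cube yields the orthogonal one (`sum_translate_eq`); hence the mean of `|f|` is a lower bound for
the projection constant (`mean_abs_walsh_family_le_projConst`). It remains to bound `‖f‖₁` from below by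
`‖f‖₂ = √|F|`, and both cases rest on the operators `T_z χ_S = z ^ |S| χ_S` with complex `z`.

* If `|S| = d` on `F`, then `T_i f` is `f` up to a phase. The entropic uncertainty inequality
  `Ent |g|² + Ent |T_i g|² ≤ 2 · energy g` (`entropy_uncertainty`) gives `Ent f² ≤ d ‖f‖₂²`, half of
  what the logarithmic Sobolev inequality gives, and Jensen's inequality for the logarithm turns
  this into `‖f‖₂ ≤ e^{d/2} ‖f‖₁`. On the two-point space the uncertainty inequality follows from the
  logarithmic Sobolev inequality, because `v ↦ 1 - √(1 - v)` is superadditive; it passes to products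
  because the entropy is superadditive.

* If `|S| ≤ d` on `F`, then `‖T_z f‖₄ ≤ ‖f‖_{4/3}` for `|z|² + (2/3) |Re z| ≤ 1/3`
  (`hypercontractive`). This domain contains the ellipse parametrized by
  `z = (2/5) v⁻¹ - (13/125) v`, `|v| = 1`, and `v ^ d T_z f` is a polynomial in `v`. The maximum
  principle on the unit disc, at the point `v = 5/13` where `z = 1`, gives
  `‖f‖₄ ≤ (13/5)^d ‖f‖_{4/3}` (`sum_pow_four_walsh_family_le`), and interpolation between `L¹` and
  `L⁴` gives `‖f‖₂ ≤ (13/5)^d ‖f‖₁`. As `13/5 < 2.69076`, this suffices.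
-/

noncomputable section

namespace BooleanProj

variable {N : ℕ}

/-! ### Sums over the cube and Walsh functions -/

theorem sum_units {M : Type*} [AddCommMonoid M] (f : ℤˣ → M) : ∑ ε, f ε = f 1 + f (-1) := by
  rw [UnitsInt.univ, Finset.sum_pair (by decide)]

theorem sum_cube_succ {M : Type*} [AddCommMonoid M] {n : ℕ} (f : Cube (n + 1) → M) :
    ∑ x, f x = ∑ ε : ℤˣ, ∑ y : Cube n, f (Fin.cons ε y) := by
  rw [← Fintype.sum_prod_type']
  exact (Fintype.sum_equiv (Fin.consEquiv fun _ => ℤˣ) _ _ fun _ => rfl).symm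

theorem card_cube (n : ℕ) : Fintype.card (Cube n) = 2 ^ n := by
  simp [Cube, Fintype.card_pi]

theorem unit_mul_self (ε : ℤˣ) : ((ε : ℤ) : ℝ) * ((ε : ℤ) : ℝ) = 1 := by
  rcases Int.units_eq_one_or ε with rfl | rfl <;> simp

theorem walsh_eq_prod (S : Finset (Fin N)) (x : Cube N) :
    walsh S x = ∏ k, if k ∈ S then ((x k : ℤ) : ℝ) else 1 := by
  simp [walsh, Finset.prod_ite_mem]

theorem walsh_mul (S : Finset (Fin N)) (x y : Cube N) :
    walsh S (x * y) = walsh S x * walsh S y := by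
  simp [walsh, Finset.prod_mul_distrib]

/-- Orthogonality of the Walsh functions. -/
theorem sum_walsh_mul_walsh (S T : Finset (Fin N)) :
    ∑ x, walsh S x * walsh T x = if S = T then 2 ^ N else 0 := by
  have h : ∀ k : Fin N, (∑ ε : ℤˣ, (if k ∈ S then ((ε : ℤ) : ℝ) else 1) *
      (if k ∈ T then ((ε : ℤ) : ℝ) else 1)) = if (k ∈ S ↔ k ∈ T) then 2 else 0 := by
    intro k
    rw [sum_units]
    by_cases hS : k ∈ S <;> by_cases hT : k ∈ T <;> simp [hS, hT] <;> norm_num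
  calc ∑ x, walsh S x * walsh T x
      = ∑ x : Cube N, ∏ k, (if k ∈ S then ((x k : ℤ) : ℝ) else 1) *
          (if k ∈ T then ((x k : ℤ) : ℝ) else 1) := by
        simp only [walsh_eq_prod, Finset.prod_mul_distrib]
    _ = ∏ k, if (k ∈ S ↔ k ∈ T) then (2 : ℝ) else 0 := by
        rw [← Finset.prod_congr rfl fun k _ => h k, Finset.prod_univ_sum, Fintype.piFinset_univ]
    _ = if S = T then 2 ^ N else 0 := by
        split_ifs with hST
        · simp [hST]
        · obtain ⟨k, hk⟩ : ∃ k, ¬(k ∈ S ↔ k ∈ T) := by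
            by_contra! hc
            exact hST (Finset.ext hc)
          exact Finset.prod_eq_zero (Finset.mem_univ k) (if_neg hk)

theorem sum_walsh_family_mul_walsh (F : Finset (Finset (Fin N))) (T : Finset (Fin N)) :
    ∑ x, (∑ S ∈ F, walsh S x) * walsh T x = if T ∈ F then 2 ^ N else 0 := by
  simp_rw [Finset.sum_mul]
  rw [Finset.sum_comm]
  simp [sum_walsh_mul_walsh]

theorem sum_walsh_family_sq (F : Finset (Finset (Fin N))) :
    ∑ x, (∑ S ∈ F, walsh S x) ^ 2 = 2 ^ N * F.card := by
  calc ∑ x, (∑ S ∈ F, walsh S x) ^ 2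
      = ∑ T ∈ F, ∑ x, (∑ S ∈ F, walsh S x) * walsh T x := by
        rw [Finset.sum_comm]
        exact Finset.sum_congr rfl fun x _ => by rw [sq, Finset.mul_sum]
    _ = ∑ T ∈ F, 2 ^ N := Finset.sum_congr rfl fun T hT => by
        rw [sum_walsh_family_mul_walsh, if_pos hT]
    _ = 2 ^ N * F.card := by rw [Finset.sum_const, nsmul_eq_mul, mul_comm]

/-- Completeness of the Walsh functions. -/
theorem sum_walsh_kernel (x y : Cube N) :
    ∑ S, walsh S x * walsh S y = if x = y then 2 ^ N else 0 := by
  calc ∑ S, walsh S x * walsh S y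
      = ∑ S ∈ (Finset.univ : Finset (Fin N)).powerset,
          ∏ k ∈ S, ((x k : ℤ) : ℝ) * ((y k : ℤ) : ℝ) := by
        simp [walsh, Finset.prod_mul_distrib]
    _ = ∏ k, (1 + ((x k : ℤ) : ℝ) * ((y k : ℤ) : ℝ)) := (Finset.prod_one_add _).symm
    _ = if x = y then 2 ^ N else 0 := by
        split_ifs with h
        · subst h
          simp only [unit_mul_self]
          norm_num
        · obtain ⟨k, hk⟩ := Function.ne_iff.1 h
          refine Finset.prod_eq_zero (Finset.mem_univ k) ?_
          rcases Int.units_eq_one_or (x k) with h1 | h1 <;>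
            rcases Int.units_eq_one_or (y k) with h2 | h2 <;> simp_all

/-- Every function on the cube is the sum of its Fourier–Walsh expansion. -/
theorem sum_walshCoeff_mul_walsh (f : Cube N → ℝ) (x : Cube N) :
    ∑ S, walshCoeff f S * walsh S x = f x := by
  calc ∑ S, walshCoeff f S * walsh S x
      = (1 / 2 ^ N) * ∑ y, f y * ∑ S, walsh S y * walsh S x := by
        simp_rw [walshCoeff, mul_assoc, ← Finset.mul_sum, Finset.sum_mul, Finset.mul_sum]
        rw [Finset.sum_comm]
        simp only [mul_assoc]
    _ = f x := by
        simp only [sum_walsh_kernel, mul_ite, mul_zero, Finset.sum_ite_eq', Finset.mem_univ,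
          if_true]
        field_simp

theorem walshCoeff_walsh (S T : Finset (Fin N)) :
    walshCoeff (walsh S) T = if S = T then 1 else 0 := by
  rw [walshCoeff, sum_walsh_mul_walsh]
  split_ifs <;> simp

theorem walsh_mem_walshSpace {F : Finset (Finset (Fin N))} {S : Finset (Fin N)} (hS : S ∈ F) :
    walsh S ∈ walshSpace F := by
  intro T hT
  rw [walshCoeff_walsh] at hT
  split_ifs at hT with h
  · exact h ▸ hS
  · simp at hT

/-! ### The noise operator with a complex parameter -/

/-- The noise operator `T_z`, given by its kernel `2^{-N} ∏_k (1 + z x_k y_k)`; it multiplies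
`χ_S` by `z ^ |S|`. -/
def noiseOp (z : ℂ) (g : Cube N → ℂ) (x : Cube N) : ℂ :=
  (1 / 2 ^ N) * ∑ y, (∏ k, (1 + z * ((x k : ℤ) : ℂ) * ((y k : ℤ) : ℂ))) * g y

theorem noiseOp_walsh (z : ℂ) (S : Finset (Fin N)) (x : Cube N) :
    noiseOp z (fun y => (walsh S y : ℂ)) x = z ^ S.card * walsh S x := by
  have h : ∀ k : Fin N, (∑ ε : ℤˣ, (1 + z * ((x k : ℤ) : ℂ) * ((ε : ℤ) : ℂ)) *
      (if k ∈ S then ((ε : ℤ) : ℂ) else 1)) = 2 * if k ∈ S then z * ((x k : ℤ) : ℂ) else 1 := by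
    intro k
    rw [sum_units]
    by_cases hS : k ∈ S <;> simp [hS] <;> ring
  have h2 : ∑ y : Cube N, (∏ k, (1 + z * ((x k : ℤ) : ℂ) * ((y k : ℤ) : ℂ))) * (walsh S y : ℂ) =
      2 ^ N * (z ^ S.card * walsh S x) := by
    calc _ = ∑ y : Cube N, ∏ k, (1 + z * ((x k : ℤ) : ℂ) * ((y k : ℤ) : ℂ)) *
            (if k ∈ S then ((y k : ℤ) : ℂ) else 1) := by
          refine Finset.sum_congr rfl fun y _ => ?_
          rw [Finset.prod_mul_distrib, walsh_eq_prod]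
          push_cast
          congr 1
          exact Finset.prod_congr rfl fun k _ => by split_ifs <;> simp
      _ = ∏ k, (2 * if k ∈ S then z * ((x k : ℤ) : ℂ) else 1) := by
          rw [← Finset.prod_congr rfl fun k _ => h k, Finset.prod_univ_sum, Fintype.piFinset_univ]
      _ = _ := by
          rw [Finset.prod_mul_distrib, Finset.prod_const, Finset.card_univ, Fintype.card_fin,
            Finset.prod_ite_mem, Finset.univ_inter, Finset.prod_mul_distrib, Finset.prod_const]
          simp [walsh]
  rw [noiseOp, h2]
  field_simp

theorem noiseOp_sum {ι : Type*} (z : ℂ) (s : Finset ι) (g : ι → Cube N → ℂ) (x : Cube N) :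
    noiseOp z (fun y => ∑ i ∈ s, g i y) x = ∑ i ∈ s, noiseOp z (g i) x := by
  simp_rw [noiseOp, Finset.mul_sum]
  rw [Finset.sum_comm]

theorem noiseOp_walsh_family (z : ℂ) (F : Finset (Finset (Fin N))) (x : Cube N) :
    noiseOp z (fun y => ((∑ S ∈ F, walsh S y : ℝ) : ℂ)) x = ∑ S ∈ F, z ^ S.card * walsh S x := by
  simp only [Complex.ofReal_sum]
  rw [noiseOp_sum]
  exact Finset.sum_congr rfl fun S _ => noiseOp_walsh z S x

/-- The action of `T_z` on the first variable only: with `u`, `v` the values of a function at `1`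
and `-1`, this is the value at `ε` of its image. -/
def noiseTwo (z : ℂ) (u v : ℂ) (ε : ℤˣ) : ℂ :=
  (1 / 2) * ((1 + z * ((ε : ℤ) : ℂ)) * u + (1 - z * ((ε : ℤ) : ℂ)) * v)

theorem noiseOp_noiseTwo (z z' : ℂ) (g h : Cube N → ℂ) (ε : ℤˣ) (x : Cube N) :
    noiseOp z (fun y => noiseTwo z' (g y) (h y) ε) x =
      noiseTwo z' (noiseOp z g x) (noiseOp z h x) ε := by
  simp only [noiseOp, noiseTwo]
  rw [show ∀ a b c d e : ℂ, 1 / 2 * (a * (b * c) + d * (b * e)) =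
    b * (1 / 2 * a * c + 1 / 2 * d * e) by intros; ring]
  congr 1
  rw [Finset.mul_sum, Finset.mul_sum, ← Finset.sum_add_distrib]
  exact Finset.sum_congr rfl fun y _ => by ring

theorem noiseOp_cons (z : ℂ) (g : Cube (N + 1) → ℂ) (ε : ℤˣ) (x : Cube N) :
    noiseOp z g (Fin.cons ε x) = noiseTwo z (noiseOp z (fun y => g (Fin.cons 1 y)) x)
      (noiseOp z (fun y => g (Fin.cons (-1) y)) x) ε := by
  rw [noiseOp, sum_cube_succ, sum_units]
  simp only [Fin.prod_univ_succ, Fin.cons_zero, Fin.cons_succ, noiseOp, noiseTwo, mul_assoc,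
    ← Finset.mul_sum, pow_succ]
  push_cast
  field_simp
  ring

/-! ### The projection constant and the `L¹` norm of the sum of the Walsh functions -/

/-- The orthogonal projection onto `walshSpace F`. -/
def walshProj (F : Finset (Finset (Fin N))) : (Cube N → ℝ) →ₗ[ℝ] walshSpace F where
  toFun g := ∑ S ∈ F.attach, walshCoeff g S • ⟨walsh S, walsh_mem_walshSpace S.2⟩
  map_add' g h := by
    rw [← Finset.sum_add_distrib]
    refine Finset.sum_congr rfl fun S _ => ?_
    rw [← add_smul]
    simp [walshCoeff, add_mul, Finset.sum_add_distrib, mul_add]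
  map_smul' c g := by
    rw [Finset.smul_sum]
    refine Finset.sum_congr rfl fun S _ => ?_
    rw [smul_smul]
    simp only [walshCoeff, Pi.smul_apply, smul_eq_mul, mul_assoc, ← Finset.mul_sum,
      RingHom.id_apply]
    rw [mul_left_comm]

theorem walshProj_apply (F : Finset (Finset (Fin N))) (g : Cube N → ℝ) (x : Cube N) :
    (walshProj F g : Cube N → ℝ) x = ∑ S ∈ F, walshCoeff g S * walsh S x := by
  simp only [walshProj, LinearMap.coe_mk, AddHom.coe_mk, AddSubmonoidClass.coe_finsetSum,
    Submodule.coe_smul, Finset.sum_apply, Pi.smul_apply, smul_eq_mul]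
  exact F.sum_attach fun S => walshCoeff g S * walsh S x

theorem walshProj_coe (F : Finset (Finset (Fin N))) (g : walshSpace F) :
    walshProj F (g : Cube N → ℝ) = g := by
  ext x
  rw [walshProj_apply, ← sum_walshCoeff_mul_walsh (g : Cube N → ℝ) x]
  refine Finset.sum_subset (Finset.subset_univ F) fun S _ hS => ?_
  rw [not_imp_comm.1 (g.2 S) hS, zero_mul]

theorem sum_mul_walsh_family (F : Finset (Finset (Fin N))) (g : Cube N → ℝ) :
    ∑ x, g x * ∑ S ∈ F, walsh S x = ∑ S ∈ F, 2 ^ N * walshCoeff g S := by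
  simp_rw [Finset.mul_sum]
  rw [Finset.sum_comm]
  refine Finset.sum_congr rfl fun S _ => ?_
  rw [walshCoeff]
  field_simp

/-- By the Cauchy–Schwarz inequality the orthogonal projection has norm at most `√|F|` with respect
to the supremum norm. -/
theorem norm_walshProj_le (F : Finset (Finset (Fin N))) (g : Cube N → ℝ) :
    ‖walshProj F g‖ ≤ √F.card * ‖g‖ := by
  refine (pi_norm_le_iff_of_nonneg (by positivity)).2 fun x => ?_
  have h1 : (walshProj F g : Cube N → ℝ) x =
      (1 / 2 ^ N) * ∑ y, g y * ∑ S ∈ F, walsh S (y * x) := by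
    rw [walshProj_apply]
    simp only [walshCoeff, walsh_mul, Finset.mul_sum, Finset.sum_mul, mul_assoc]
    rw [Finset.sum_comm]
  have h2 : ∑ y : Cube N, (∑ S ∈ F, walsh S (y * x)) ^ 2 = 2 ^ N * F.card := by
    rw [← sum_walsh_family_sq F]
    exact Fintype.sum_equiv (Equiv.mulRight x) _ _ fun _ => rfl
  have h3 : ∑ y : Cube N, g y ^ 2 ≤ 2 ^ N * ‖g‖ ^ 2 := by
    calc ∑ y : Cube N, g y ^ 2 ≤ ∑ _y : Cube N, ‖g‖ ^ 2 := by
          refine Finset.sum_le_sum fun y _ => ?_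
          rw [← sq_abs]
          have := norm_le_pi_norm g y
          rw [Real.norm_eq_abs] at this
          gcongr
      _ = 2 ^ N * ‖g‖ ^ 2 := by simp [Finset.card_univ]
  have h4 := Finset.sum_mul_sq_le_sq_mul_sq Finset.univ g fun y => ∑ S ∈ F, walsh S (y * x)
  change |(walshProj F g : Cube N → ℝ) x| ≤ _
  rw [h1]
  refine abs_le_of_sq_le_sq ?_ (by positivity)
  rw [mul_pow, mul_pow, Real.sq_sqrt (by positivity), h2] at *
  calc (1 / 2 ^ N : ℝ) ^ 2 * (∑ y, g y * ∑ S ∈ F, walsh S (y * x)) ^ 2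
      ≤ (1 / 2 ^ N : ℝ) ^ 2 * ((2 ^ N * ‖g‖ ^ 2) * (2 ^ N * F.card)) := by
        gcongr
        exact h4.trans (by gcongr)
    _ = F.card * ‖g‖ ^ 2 := by field_simp

theorem projConst_walshSpace_le (F : Finset (Finset (Fin N))) :
    projConst.{w, 0} (walshSpace F) ≤ ENNReal.ofReal √F.card := by
  refine iSup_le fun Z => iSup_le fun _ => iSup_le fun _ => iSup_le fun _ => iSup_le fun I => ?_
  let e : walshSpace F ≃ₗᵢ[ℝ] LinearMap.range I.toLinearMap := I.equivRange
  -- the coordinates of `I⁻¹`, extended to `Z` by the Hahn–Banach theorem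
  let l : Cube N → (LinearMap.range I.toLinearMap →L[ℝ] ℝ) := fun x =>
    ((ContinuousLinearMap.proj x : (Cube N → ℝ) →L[ℝ] ℝ).comp (walshSpace F).subtypeL).comp
      (e.symm : _ →L[ℝ] walshSpace F)
  have hl : ∀ x z, l x z = (e.symm z : Cube N → ℝ) x := fun x z => rfl
  have hl_norm : ∀ x, ‖l x‖ ≤ 1 := fun x => by
    refine ContinuousLinearMap.opNorm_le_bound _ zero_le_one fun z => ?_
    rw [hl, one_mul, ← e.symm.norm_map z]
    exact norm_le_pi_norm (e.symm z : Cube N → ℝ) x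
  choose g hg hg_norm using fun x => exists_extension_norm_eq _ (l x)
  let Q : Z →ₗ[ℝ] LinearMap.range I.toLinearMap :=
    e.toLinearEquiv.toLinearMap ∘ₗ walshProj F ∘ₗ (ContinuousLinearMap.pi g).toLinearMap
  have hQ : ∀ z, Q z = e (walshProj F fun x => g x z) := fun z => rfl
  have hbound : ∀ z, ‖Q z‖ ≤ √F.card * ‖z‖ := fun z => by
    rw [hQ, e.norm_map]
    refine (norm_walshProj_le F _).trans ?_
    gcongr
    refine (pi_norm_le_iff_of_nonneg (norm_nonneg z)).2 fun x => ?_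
    calc ‖g x z‖ ≤ ‖g x‖ * ‖z‖ := (g x).le_opNorm z
      _ ≤ 1 * ‖z‖ := by
        gcongr
        exact (hg_norm x).trans_le (hl_norm x)
      _ = ‖z‖ := one_mul _
  refine (iInf₂_le (Q.mkContinuous _ hbound) fun z => ?_).trans
    (ENNReal.ofReal_le_ofReal (Q.mkContinuous_norm_le (by positivity) hbound))
  rw [LinearMap.mkContinuous_apply, hQ]
  simp_rw [hg, hl]
  rw [walshProj_coe, e.apply_symm_apply]

/-- Averaging a projection onto `walshSpace F` over the translations of the cube gives the
orthogonal projection. -/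
theorem sum_translate_eq {F : Finset (Finset (Fin N))} (A : (Cube N → ℝ) →ₗ[ℝ] (Cube N → ℝ))
    (hmem : ∀ g, A g ∈ walshSpace F) (hfix : ∀ g ∈ walshSpace F, A g = g) (g : Cube N → ℝ) :
    ∑ a, A (fun x => g (a * x)) a = ∑ x, g x * ∑ S ∈ F, walsh S x := by
  have h1 : ∀ S, ∑ a, walsh S a * A (walsh S) a = if S ∈ F then 2 ^ N else 0 := by
    intro S
    split_ifs with hS
    · rw [hfix _ (walsh_mem_walshSpace hS), sum_walsh_mul_walsh, if_pos rfl]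
    · have h := not_imp_comm.1 (hmem (walsh S) S) hS
      rw [walshCoeff, mul_eq_zero] at h
      simp_rw [mul_comm (walsh S _)]
      exact h.resolve_left (by positivity)
  have h2 : ∀ a : Cube N, (fun x => g (a * x)) =
      ∑ S, (walshCoeff g S * walsh S a) • walsh S := by
    intro a
    ext x
    rw [← sum_walshCoeff_mul_walsh g (a * x)]
    simp [walsh_mul, mul_assoc]
  calc ∑ a, A (fun x => g (a * x)) a
      = ∑ a, ∑ S, walshCoeff g S * (walsh S a * A (walsh S) a) := by
        refine Finset.sum_congr rfl fun a _ => ?_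
        rw [h2, map_sum, Finset.sum_apply]
        simp [mul_assoc]
    _ = ∑ S, walshCoeff g S * if S ∈ F then 2 ^ N else 0 := by
        rw [Finset.sum_comm]
        simp_rw [← Finset.mul_sum, h1]
    _ = ∑ x, g x * ∑ S ∈ F, walsh S x := by
        simp [sum_mul_walsh_family, mul_comm]

theorem mean_abs_walsh_family_le_of_projection {F : Finset (Finset (Fin N))}
    (A : (Cube N → ℝ) →ₗ[ℝ] (Cube N → ℝ)) (hmem : ∀ g, A g ∈ walshSpace F)
    (hfix : ∀ g ∈ walshSpace F, A g = g) {C : ℝ} (hC : 0 ≤ C) (hA : ∀ g, ‖A g‖ ≤ C * ‖g‖) :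
    (1 / 2 ^ N) * ∑ x, |∑ S ∈ F, walsh S x| ≤ C := by
  let g : Cube N → ℝ := fun x => if 0 ≤ ∑ S ∈ F, walsh S x then 1 else -1
  have hg : ∀ x, |∑ S ∈ F, walsh S x| = g x * ∑ S ∈ F, walsh S x := by
    intro x
    simp only [g]
    split_ifs with h
    · rw [abs_of_nonneg h, one_mul]
    · rw [abs_of_neg (not_le.1 h), neg_one_mul]
  have h1 : ∀ a : Cube N, A (fun x => g (a * x)) a ≤ C := by
    intro a
    refine (le_abs_self _).trans ((norm_le_pi_norm (A fun x => g (a * x)) a).trans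
      ((hA _).trans (mul_le_of_le_one_right hC ?_)))
    refine (pi_norm_le_iff_of_nonneg zero_le_one).2 fun x => ?_
    simp only [g]
    split_ifs <;> simp
  simp_rw [hg]
  rw [← sum_translate_eq A hmem hfix g]
  calc (1 / 2 ^ N : ℝ) * ∑ a, A (fun x => g (a * x)) a
      ≤ (1 / 2 ^ N) * ∑ _a : Cube N, C := by
        gcongr with a
        exact h1 a
    _ = C := by
        rw [Finset.sum_const, Finset.card_univ, card_cube, nsmul_eq_mul]
        push_cast
        field_simp

theorem mean_abs_walsh_family_le_projConst (F : Finset (Finset (Fin N))) :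
    ENNReal.ofReal ((1 / 2 ^ N) * ∑ x, |∑ S ∈ F, walsh S x|) ≤
      projConst.{w, 0} (walshSpace F) := by
  let I : walshSpace F →ₗᵢ[ℝ] ULift.{w} (Cube N → ℝ) :=
    { toLinearMap := ULift.moduleEquiv.symm.toLinearMap ∘ₗ (walshSpace F).subtype
      norm_map' := fun _ => rfl }
  refine le_iSup_of_le (ULift.{w} (Cube N → ℝ)) <| le_iSup_of_le inferInstance <|
    le_iSup_of_le inferInstance <| le_iSup_of_le inferInstance <| le_iSup_of_le I ?_
  refine le_iInf₂ fun P hP => ENNReal.ofReal_le_ofReal ?_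
  refine mean_abs_walsh_family_le_of_projection
    (ULift.moduleEquiv.toLinearMap ∘ₗ (LinearMap.range I.toLinearMap).subtype ∘ₗ
      P.toLinearMap ∘ₗ ULift.moduleEquiv.symm.toLinearMap)
    (fun g => ?_) (fun g hg => ?_) (norm_nonneg P) fun g => ?_
  · obtain ⟨h, hh⟩ := (P (ULift.up g)).2
    have h1 : (P (ULift.up g) : ULift.{w} (Cube N → ℝ)).down = h := by
      rw [← hh]
      rfl
    change (P (ULift.up g) : ULift.{w} (Cube N → ℝ)).down ∈ walshSpace F
    rw [h1]
    exact h.2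
  · have h1 := hP ⟨ULift.up g, ⟨g, hg⟩, rfl⟩
    exact congrArg (fun z : LinearMap.range I.toLinearMap => (z : ULift.{w} (Cube N → ℝ)).down) h1
  · exact P.le_opNorm (ULift.up g)

/-! ### The entropic uncertainty inequality for `T_i` -/

theorem log_one_add_sub_log_one_sub_le {t : ℝ} (h0 : 0 ≤ t) (h1 : t < 1) :
    Real.log (1 + t) - Real.log (1 - t) ≤ 2 * t / √(1 - t ^ 2) := by
  have hp : 0 < 1 + t := by linarith
  have hm : 0 < 1 - t := by linarith
  set a := √(1 + t) with ha
  set b := √(1 - t) with hb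
  have ha0 : 0 < a := Real.sqrt_pos.2 hp
  have hb0 : 0 < b := Real.sqrt_pos.2 hm
  have ha2 : a ^ 2 = 1 + t := Real.sq_sqrt hp.le
  have hb2 : b ^ 2 = 1 - t := Real.sq_sqrt hm.le
  have hab : √(1 - t ^ 2) = a * b := by
    rw [ha, hb, ← Real.sqrt_mul hp.le]
    ring_nf
  -- `x ≤ sinh x` at `x = log (a / b)`
  have h2 : Real.log (a / b) ≤ (a / b - (a / b)⁻¹) / 2 := by
    rw [← Real.sinh_log (by positivity)]
    refine Real.self_le_sinh_iff.2 (Real.log_nonneg ?_)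
    rw [one_le_div hb0]
    exact Real.sqrt_le_sqrt (by linarith)
  rw [Real.log_div ha0.ne' hb0.ne'] at h2
  have h3 : Real.log (1 + t) - Real.log (1 - t) = 2 * (Real.log a - Real.log b) := by
    rw [← ha2, ← hb2, Real.log_pow, Real.log_pow]
    push_cast
    ring
  have h4 : 2 * t / √(1 - t ^ 2) = a / b - (a / b)⁻¹ := by
    rw [hab]
    field_simp
    linarith
  rw [h3, h4]
  linarith

/-- The logarithmic Sobolev inequality on the two-point space, for the function with values
`√(1 + t)` and `√(1 - t)`. -/
theorem two_point_log_sobolev {t : ℝ} (ht : |t| ≤ 1) :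
    (1 + t) * Real.log (1 + t) + (1 - t) * Real.log (1 - t) ≤ 2 - 2 * √(1 - t ^ 2) := by
  wlog h0 : 0 ≤ t generalizing t
  · have := this (t := -t) (by rwa [abs_neg]) (by linarith)
    rw [neg_sq, sub_neg_eq_add, ← sub_eq_add_neg] at this
    linarith
  let f : ℝ → ℝ := fun t => 2 - 2 * √(1 - t ^ 2) -
    ((1 + t) * Real.log (1 + t) + (1 - t) * Real.log (1 - t))
  have hmono : MonotoneOn f (Set.Icc 0 1) := by
    refine monotoneOn_of_hasDerivWithinAt_nonneg (f' := fun t => 2 * t / √(1 - t ^ 2) -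
      (Real.log (1 + t) - Real.log (1 - t))) (convex_Icc 0 1) ?_ ?_ ?_
    · refine Continuous.continuousOn ?_
      have := Real.continuous_mul_log
      exact (by fun_prop : Continuous fun t : ℝ => 2 - 2 * √(1 - t ^ 2)).sub
        ((this.comp (by fun_prop : Continuous fun t : ℝ => 1 + t)).add
          (this.comp (by fun_prop : Continuous fun t : ℝ => 1 - t)))
    · intro x hx
      rw [interior_Icc] at hx
      have hp : 1 + x ≠ 0 := by linarith [hx.1]
      have hm : 1 - x ≠ 0 := by linarith [hx.2]
      have hs : 1 - x ^ 2 ≠ 0 := by nlinarith [hx.1, hx.2]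
      have d1 : HasDerivAt (fun t : ℝ => 1 + t) 1 x := (hasDerivAt_id x).const_add 1
      have d2 : HasDerivAt (fun t : ℝ => 1 - t) (-1) x := (hasDerivAt_id x).const_sub 1
      have d3 : HasDerivAt (fun t : ℝ => 1 - t ^ 2) (-(2 * x)) x := by
        simpa using (hasDerivAt_pow 2 x).const_sub 1
      have d4 := (((d3.sqrt hs).const_mul 2).const_sub 2).sub
        (((Real.hasDerivAt_mul_log hp).comp x d1).add ((Real.hasDerivAt_mul_log hm).comp x d2))
      refine (d4.congr_deriv ?_).hasDerivWithinAt
      have : √(1 - x ^ 2) ≠ 0 := (Real.sqrt_pos.2 (by nlinarith [hx.1, hx.2])).ne'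
      field_simp
      ring
    · intro x hx
      rw [interior_Icc] at hx
      exact sub_nonneg.2 (log_one_add_sub_log_one_sub_le hx.1.le hx.2)
  have h1 := hmono (Set.left_mem_Icc.2 zero_le_one) ⟨h0, (le_abs_self t).trans ht⟩ h0
  simp only [f] at h1
  norm_num at h1
  linarith

theorem two_point_log_sobolev_scaled {m e : ℝ} (he : |e| ≤ m) :
    (m + e) * Real.log (m + e) + (m - e) * Real.log (m - e) ≤
      2 * m * Real.log m + 2 * m - 2 * √(m ^ 2 - e ^ 2) := by
  rcases ((abs_nonneg e).trans he).eq_or_lt with hm | hm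
  · have : e = 0 := abs_eq_zero.1 (le_antisymm (hm ▸ he) (abs_nonneg e))
    simp [← hm, this]
  have h1 := two_point_log_sobolev (t := e / m) (by rwa [abs_div, abs_of_pos hm, div_le_one hm])
  have hmul : ∀ s : ℝ, m * s * Real.log (m * s) = m * s * Real.log m + m * (s * Real.log s) := by
    intro s
    rcases eq_or_ne s 0 with rfl | hs
    · simp
    · rw [Real.log_mul hm.ne' hs]
      ring
  have hp : m + e = m * (1 + e / m) := by field_simp
  have hn : m - e = m * (1 - e / m) := by field_simp
  have hs : √(m ^ 2 - e ^ 2) = m * √(1 - (e / m) ^ 2) := by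
    rw [show m ^ 2 - e ^ 2 = m ^ 2 * (1 - (e / m) ^ 2) by field_simp, Real.sqrt_mul (sq_nonneg m),
      Real.sqrt_sq hm.le]
  rw [hs, hp, hn, hmul, hmul]
  nlinarith

theorem norm_sq_noiseTwo_I (u v : ℂ) (ε : ℤˣ) :
    ‖noiseTwo Complex.I u v ε‖ ^ 2 =
      (‖u‖ ^ 2 + ‖v‖ ^ 2) / 2 + ((ε : ℤ) : ℝ) * (u.re * v.im - u.im * v.re) := by
  rw [Complex.sq_norm, Complex.sq_norm, Complex.sq_norm]
  rcases Int.units_eq_one_or ε with rfl | rfl <;>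
    simp [noiseTwo, Complex.normSq_apply] <;> ring

theorem noiseTwo_I_isometry (u v : ℂ) :
    ‖noiseTwo Complex.I u v 1‖ ^ 2 + ‖noiseTwo Complex.I u v (-1)‖ ^ 2 = ‖u‖ ^ 2 + ‖v‖ ^ 2 := by
  rw [norm_sq_noiseTwo_I, norm_sq_noiseTwo_I]
  simp
  ring

/-- The entropic uncertainty inequality on the two-point space: the sum of the entropies of a
complex function and of its image under `T_i` is at most twice the energy. -/
theorem two_point_entropy_uncertainty (u v : ℂ) :
    ‖u‖ ^ 2 * Real.log (‖u‖ ^ 2) + ‖v‖ ^ 2 * Real.log (‖v‖ ^ 2) +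
      (‖noiseTwo Complex.I u v 1‖ ^ 2 * Real.log (‖noiseTwo Complex.I u v 1‖ ^ 2) +
        ‖noiseTwo Complex.I u v (-1)‖ ^ 2 * Real.log (‖noiseTwo Complex.I u v (-1)‖ ^ 2)) +
      2 * (‖u‖ ^ 2 + ‖v‖ ^ 2) * Real.log 2 ≤
      2 * ((‖u‖ ^ 2 + ‖v‖ ^ 2) * Real.log (‖u‖ ^ 2 + ‖v‖ ^ 2)) + ‖u - v‖ ^ 2 := by
  rw [norm_sq_noiseTwo_I, norm_sq_noiseTwo_I]
  set c := u.re * v.re + u.im * v.im with hc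
  set e := u.re * v.im - u.im * v.re with he
  have hce : c ^ 2 + e ^ 2 = ‖u‖ ^ 2 * ‖v‖ ^ 2 := by
    rw [Complex.sq_norm, Complex.sq_norm, Complex.normSq_apply, Complex.normSq_apply]
    ring
  have huv : ‖u - v‖ ^ 2 = ‖u‖ ^ 2 + ‖v‖ ^ 2 - 2 * c := by
    rw [Complex.sq_norm, Complex.sq_norm, Complex.sq_norm, Complex.normSq_apply,
      Complex.normSq_apply, Complex.normSq_apply, Complex.sub_re, Complex.sub_im]
    ring
  rw [huv]
  have hp : 0 ≤ ‖u‖ ^ 2 := by positivity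
  have hq : 0 ≤ ‖v‖ ^ 2 := by positivity
  clear_value c e
  generalize ‖u‖ ^ 2 = p at *
  generalize ‖v‖ ^ 2 = q at *
  obtain ⟨m, hm⟩ : ∃ m, m = (p + q) / 2 := ⟨_, rfl⟩
  have hm0 : 0 ≤ m := by linarith
  have hpq : p * q ≤ m ^ 2 := by nlinarith [sq_nonneg (p - q)]
  have hem : |e| ≤ m := abs_le_of_sq_le_sq (by nlinarith [sq_nonneg c]) hm0
  have h1 := two_point_log_sobolev_scaled (m := m) (e := (p - q) / 2)
    (abs_le.2 ⟨by linarith, by linarith⟩)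
  have h2 := two_point_log_sobolev_scaled hem
  rw [show m + (p - q) / 2 = p by linarith, show m - (p - q) / 2 = q by linarith,
    show m ^ 2 - ((p - q) / 2) ^ 2 = c ^ 2 + e ^ 2 by rw [hce, hm]; ring] at h1
  -- superadditivity of `v ↦ 1 - √(1 - v)`
  have h3 : m + c ≤ √(c ^ 2 + e ^ 2) + √(m ^ 2 - e ^ 2) := by
    have hA : 0 ≤ c ^ 2 + e ^ 2 := by positivity
    have hB : 0 ≤ m ^ 2 - e ^ 2 := by nlinarith [sq_nonneg c]
    refine (le_abs_self _).trans (abs_le_of_sq_le_sq ?_ (by positivity))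
    have h4 : m * c ≤ √(c ^ 2 + e ^ 2) * √(m ^ 2 - e ^ 2) := by
      refine (le_abs_self _).trans (abs_le_of_sq_le_sq ?_ (by positivity))
      rw [mul_pow, mul_pow, Real.sq_sqrt hA, Real.sq_sqrt hB]
      nlinarith [mul_nonneg (sq_nonneg e) (by linarith : 0 ≤ m ^ 2 - (c ^ 2 + e ^ 2))]
    nlinarith [Real.sq_sqrt hA, Real.sq_sqrt hB]
  have h5 : (p + q) * Real.log m = (p + q) * Real.log (p + q) - (p + q) * Real.log 2 := by
    rcases eq_or_ne (p + q) 0 with h | h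
    · simp [h]
    · rw [hm, Real.log_div h two_ne_zero]
      ring
  simp only [Units.val_one, Int.cast_one, one_mul, Units.val_neg, Int.cast_neg, neg_mul,
    ← sub_eq_add_neg, ← hm]
  have h6 : 2 * m * Real.log m = (p + q) * Real.log m := by rw [hm]; ring
  linarith

/-- Superadditivity of the entropy: the mutual information is nonnegative. -/
theorem sum_marginal_mul_log_le {ι κ : Type*} [Fintype ι] [Fintype κ] (f : ι → κ → ℝ)
    (hf : ∀ i j, 0 ≤ f i j) :
    ∑ i, (∑ j, f i j) * Real.log (∑ j, f i j) + ∑ j, (∑ i, f i j) * Real.log (∑ i, f i j) ≤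
      ∑ i, ∑ j, f i j * Real.log (f i j) +
        (∑ i, ∑ j, f i j) * Real.log (∑ i, ∑ j, f i j) := by
  set a : ι → ℝ := fun i => ∑ j, f i j with ha
  set b : κ → ℝ := fun j => ∑ i, f i j with hb
  set m := ∑ i, a i with hm
  have hbm : ∑ j, b j = m := Finset.sum_comm
  have hfa : ∀ i j, f i j ≤ a i := fun i j =>
    Finset.single_le_sum (fun j _ => hf i j) (Finset.mem_univ j)
  have hfb : ∀ i j, f i j ≤ b j := fun i j =>
    Finset.single_le_sum (f := fun i => f i j) (fun i _ => hf i j) (Finset.mem_univ i)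
  have ha0 : ∀ i, 0 ≤ a i := fun i => Finset.sum_nonneg fun j _ => hf i j
  have hb0 : ∀ j, 0 ≤ b j := fun j => Finset.sum_nonneg fun i _ => hf i j
  have ham : ∀ i, a i ≤ m := fun i => Finset.single_le_sum (fun i _ => ha0 i) (Finset.mem_univ i)
  have key : ∀ i j, f i j - a i * b j / m ≤ f i j * Real.log (f i j) -
      f i j * Real.log (a i) - f i j * Real.log (b j) + f i j * Real.log m := by
    intro i j
    rcases (hf i j).eq_or_lt with h | h
    · rw [← h]
      have : 0 ≤ a i * b j / m := by
        have := ha0 i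
        have := hb0 j
        have := (ha0 i).trans (ham i)
        positivity
      simpa using this
    · have h1 := h.trans_le (hfa i j)
      have h2 := h.trans_le (hfb i j)
      have h3 := h1.trans_le (ham i)
      have h4 := Real.log_le_sub_one_of_pos (x := a i * b j / (m * f i j)) (by positivity)
      rw [Real.log_div (by positivity) (by positivity), Real.log_mul h1.ne' h2.ne',
        Real.log_mul h3.ne' h.ne'] at h4
      have h5 : f i j * (a i * b j / (m * f i j)) = a i * b j / m := by field_simp
      nlinarith
  have h1 : ∑ i, ∑ j, (f i j - a i * b j / m) = 0 := by
    simp_rw [Finset.sum_sub_distrib, ← Finset.sum_div, ← Finset.mul_sum, hbm, ← Finset.sum_mul]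
    change m - m * m / m = 0
    rw [mul_self_div_self, sub_self]
  have h2 := Finset.sum_le_sum fun i (_ : i ∈ Finset.univ) =>
    Finset.sum_le_sum fun j (_ : j ∈ Finset.univ) => key i j
  rw [h1] at h2
  have h3 : ∑ i, ∑ j, f i j * Real.log (b j) = ∑ j, b j * Real.log (b j) := by
    rw [Finset.sum_comm]
    simp_rw [← Finset.sum_mul, hb]
  simp_rw [Finset.sum_add_distrib, Finset.sum_sub_distrib] at h2
  rw [h3] at h2
  simp_rw [← Finset.sum_mul] at h2
  change 0 ≤ _ - ∑ i, a i * Real.log (a i) - _ + m * Real.log m at h2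
  linarith

/-- The energy `∑_k ‖D_k g‖²` of a function on the cube, `D_k` being the part of `g` that is odd in
the variable `x_k`; the norm is that of `ℓ²`, without normalisation. -/
def energy (g : Cube N → ℂ) : ℝ :=
  ∑ k, ∑ x : Cube N, ‖(g x - g (Function.update x k (-x k))) / 2‖ ^ 2

theorem energy_succ (g : Cube (N + 1) → ℂ) :
    energy g = ∑ x : Cube N, ‖g (Fin.cons 1 x) - g (Fin.cons (-1) x)‖ ^ 2 / 2 +
      ∑ ε : ℤˣ, energy fun x : Cube N => g (Fin.cons ε x) := by
  simp only [energy]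
  rw [Fin.sum_univ_succ]
  congr 1
  · rw [sum_cube_succ, sum_units, ← Finset.sum_add_distrib]
    refine Finset.sum_congr rfl fun x _ => ?_
    simp only [Fin.update_cons_zero, Fin.cons_zero, neg_neg, norm_div, div_pow]
    rw [norm_sub_rev (g (Fin.cons (-1) x))]
    norm_num
    ring
  · rw [Finset.sum_comm (s := (Finset.univ : Finset ℤˣ))]
    refine Finset.sum_congr rfl fun k _ => ?_
    rw [sum_cube_succ]
    simp only [Fin.cons_succ, Fin.cons_update]

theorem energy_noiseTwo_I (g h : Cube N → ℂ) :
    ∑ ε : ℤˣ, energy (fun x => noiseTwo Complex.I (g x) (h x) ε) = energy g + energy h := by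
  rw [sum_units]
  simp only [energy, ← Finset.sum_add_distrib]
  refine Finset.sum_congr rfl fun k _ => Finset.sum_congr rfl fun x _ => ?_
  rw [← noiseTwo_I_isometry ((g x - g (Function.update x k (-x k))) / 2)]
  congr 3 <;> simp only [noiseTwo] <;> ring

/-- The entropic uncertainty inequality on the cube: `Ent |g|² + Ent |T_i g|²` is at most twice the
energy of `g`. It tensorizes because the entropy is superadditive. -/
theorem entropy_uncertainty : ∀ {N : ℕ} (g : Cube N → ℂ),
    ∑ x, ‖g x‖ ^ 2 * Real.log (‖g x‖ ^ 2) +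
      ∑ x, ‖noiseOp Complex.I g x‖ ^ 2 * Real.log (‖noiseOp Complex.I g x‖ ^ 2) +
      2 * (∑ x, ‖g x‖ ^ 2) * (N * Real.log 2) ≤
      2 * ((∑ x, ‖g x‖ ^ 2) * Real.log (∑ x, ‖g x‖ ^ 2)) + 2 * energy g := by
  intro N
  induction N with
  | zero =>
    intro g
    simp [energy, noiseOp]
    linarith
  | succ n ih =>
    intro g
    set u : Cube n → ℂ := fun x => g (Fin.cons 1 x) with hu
    set v : Cube n → ℂ := fun x => g (Fin.cons (-1) x) with hv
    -- the image of `g` under `T_i` in the first variable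
    set h : ℤˣ → Cube n → ℂ := fun ε x => noiseTwo Complex.I (u x) (v x) ε with hh
    have hT : ∀ ε x, noiseOp Complex.I g (Fin.cons ε x) = noiseOp Complex.I (h ε) x :=
      fun ε x => by rw [noiseOp_cons, ← noiseOp_noiseTwo]
    have hiso : ∀ x, ∑ ε, ‖h ε x‖ ^ 2 = ‖u x‖ ^ 2 + ‖v x‖ ^ 2 := fun x => by
      rw [sum_units]
      exact noiseTwo_I_isometry _ _
    have h1 := Finset.sum_le_sum fun x (_ : x ∈ Finset.univ) =>
      two_point_entropy_uncertainty (u x) (v x)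
    have h2 := Finset.sum_le_sum fun ε (_ : ε ∈ Finset.univ) => ih (h ε)
    have h3 := sum_marginal_mul_log_le (fun x ε => ‖h ε x‖ ^ 2) fun _ _ => by positivity
    simp_rw [hiso] at h3
    have hsum : ∑ x, ‖g x‖ ^ 2 = ∑ x, (‖u x‖ ^ 2 + ‖v x‖ ^ 2) := by
      rw [sum_cube_succ, sum_units, Finset.sum_add_distrib]
    have hsum' : ∑ ε, ∑ x, ‖h ε x‖ ^ 2 = ∑ x, (‖u x‖ ^ 2 + ‖v x‖ ^ 2) := by
      rw [Finset.sum_comm]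
      simp_rw [hiso]
    have hen : ∑ ε, energy (h ε) = ∑ ε : ℤˣ, energy fun x : Cube n => g (Fin.cons ε x) := by
      rw [hh, energy_noiseTwo_I, sum_units]
    rw [energy_succ, ← hen, hsum, sum_cube_succ, sum_cube_succ]
    simp_rw [hT]
    simp only [Finset.sum_add_distrib, ← Finset.mul_sum, ← Finset.sum_mul, sum_units,
      ← Finset.sum_div] at h1 h2 h3 hsum' ⊢
    push_cast
    simp only [← hsum'] at h1 h3 ⊢
    linarith

/-! ### Families of sets of the same size -/

theorem walsh_update_neg (S : Finset (Fin N)) (x : Cube N) (k : Fin N) :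
    walsh S (Function.update x k (-x k)) = if k ∈ S then -walsh S x else walsh S x := by
  have h : ∀ j ∈ S, j ≠ k → ((Function.update x k (-x k) j : ℤˣ) : ℤ) = x j := fun j _ hj => by
    rw [Function.update_of_ne hj]
  split_ifs with hk
  · rw [walsh, walsh, ← Finset.mul_prod_erase S _ hk, ← Finset.mul_prod_erase S _ hk,
      Finset.prod_congr rfl fun j hj => by
        rw [h j (Finset.mem_of_mem_erase hj) (Finset.ne_of_mem_erase hj)]]
    simp
  · exact Finset.prod_congr rfl fun j hj => by rw [h j hj fun hjk => hk (hjk ▸ hj)]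

theorem energy_walsh_family (F : Finset (Finset (Fin N))) :
    energy (fun x => ((∑ S ∈ F, walsh S x : ℝ) : ℂ)) = 2 ^ N * ∑ S ∈ F, (S.card : ℝ) := by
  have h1 : ∀ (k : Fin N) (x : Cube N),
      ‖(((∑ S ∈ F, walsh S x : ℝ) : ℂ) -
        ((∑ S ∈ F, walsh S (Function.update x k (-x k)) : ℝ) : ℂ)) / 2‖ ^ 2 =
      (∑ S ∈ F with k ∈ S, walsh S x) ^ 2 := by
    intro k x
    rw [← Complex.ofReal_sub, ← Finset.sum_sub_distrib, Finset.sum_filter,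
      show (2 : ℂ) = ((2 : ℝ) : ℂ) by norm_num, ← Complex.ofReal_div, Complex.norm_real,
      Real.norm_eq_abs, sq_abs, Finset.sum_div]
    congr 1
    refine Finset.sum_congr rfl fun S _ => ?_
    rw [walsh_update_neg]
    split_ifs <;> ring
  simp only [energy, h1, sum_walsh_family_sq, ← Finset.mul_sum, Finset.card_filter]
  push_cast
  rw [Finset.sum_comm]
  simp

/-- The homogeneous case: `f = ∑_{S ∈ F} χ_S` is an eigenvector of `T_i` with an eigenvalue of
modulus one, so that the two entropies in the uncertainty inequality coincide. -/
theorem sum_sq_mul_log_walsh_family_le {F : Finset (Finset (Fin N))} {d : ℕ}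
    (hF : ∀ S ∈ F, S.card = d) (hne : F.Nonempty) :
    ∑ x, (∑ S ∈ F, walsh S x) ^ 2 * Real.log ((∑ S ∈ F, walsh S x) ^ 2) ≤
      2 ^ N * F.card * (Real.log F.card + d) := by
  have h := entropy_uncertainty fun x => ((∑ S ∈ F, walsh S x : ℝ) : ℂ)
  have h1 : ∀ x : Cube N, ‖((∑ S ∈ F, walsh S x : ℝ) : ℂ)‖ ^ 2 = (∑ S ∈ F, walsh S x) ^ 2 :=
    fun x => by rw [Complex.norm_real, Real.norm_eq_abs, sq_abs]
  have h2 : ∀ x : Cube N,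
      ‖noiseOp Complex.I (fun x => ((∑ S ∈ F, walsh S x : ℝ) : ℂ)) x‖ ^ 2 =
        (∑ S ∈ F, walsh S x) ^ 2 := fun x => by
    rw [noiseOp_walsh_family, Finset.sum_congr rfl fun S hS => by rw [hF S hS], ← Finset.mul_sum,
      ← Complex.ofReal_sum, norm_mul, norm_pow, Complex.norm_I, one_pow, one_mul, h1]
  have h3 : ∑ S ∈ F, (S.card : ℝ) = F.card * d := by
    rw [Finset.sum_congr rfl fun S hS => by rw [hF S hS], Finset.sum_const, nsmul_eq_mul]
  have hc : (F.card : ℝ) ≠ 0 := by exact_mod_cast hne.card_pos.ne'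
  simp only [h1, h2, energy_walsh_family, h3, sum_walsh_family_sq] at h
  rw [Real.log_mul (by positivity) hc, Real.log_pow] at h
  linarith

theorem sqrt_card_le_mean_abs_of_card_eq {F : Finset (Finset (Fin N))} {d : ℕ}
    (hF : ∀ S ∈ F, S.card = d) :
    1 / Real.exp ((d : ℝ) / 2) * √(F.card : ℝ) ≤
      (1 / 2 ^ N) * ∑ x, |∑ S ∈ F, walsh S x| := by
  rcases F.eq_empty_or_nonempty with rfl | hne
  · simp
  have hc : (0 : ℝ) < F.card := by exact_mod_cast hne.card_pos
  have hent := sum_sq_mul_log_walsh_family_le hF hne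
  have hsq := sum_walsh_family_sq F
  set f : Cube N → ℝ := fun x => ∑ S ∈ F, walsh S x with hf
  change ∑ x, f x ^ 2 * Real.log (f x ^ 2) ≤ _ at hent
  change ∑ x, f x ^ 2 = _ at hsq
  change _ ≤ 1 / 2 ^ N * ∑ x, |f x|
  -- Jensen's inequality for `log` with respect to the measure `f²`, with equality at `|f| = c⁻¹`
  set c : ℝ := Real.exp (-(d : ℝ) / 2) / √(F.card : ℝ) with hcdef
  have hc0 : 0 < c := by positivity
  have hlogc : Real.log c = -(d : ℝ) / 2 - Real.log F.card / 2 := by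
    rw [hcdef, Real.log_div (by positivity) (by positivity), Real.log_exp, Real.log_sqrt hc.le]
  have hpt : ∀ x, c * (f x ^ 2 * (1 - Real.log c)) - c / 2 * (f x ^ 2 * Real.log (f x ^ 2)) ≤
      |f x| := by
    intro x
    rcases eq_or_ne (f x) 0 with h | h
    · simp [h]
    · have h0 : 0 < |f x| := abs_pos.2 h
      have h1 := Real.log_le_sub_one_of_pos (x := 1 / (c * |f x|)) (by positivity)
      rw [one_div, Real.log_inv, Real.log_mul hc0.ne' h0.ne'] at h1
      rw [← sq_abs, Real.log_pow]
      have h2 : c * |f x| ^ 2 * (c * |f x|)⁻¹ = |f x| := by field_simp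
      have h3 : c * |f x| ^ 2 * (1 - Real.log c - Real.log |f x|) ≤ c * |f x| ^ 2 * (c * |f x|)⁻¹ :=
        mul_le_mul_of_nonneg_left (by linarith) (by positivity)
      rw [h2] at h3
      push_cast
      linarith
  have hsum := Finset.sum_le_sum fun x (_ : x ∈ Finset.univ) => hpt x
  rw [Finset.sum_sub_distrib, ← Finset.mul_sum, ← Finset.mul_sum, ← Finset.sum_mul, hsq,
    hlogc] at hsum
  have h1 : c * (2 ^ N * F.card) ≤ ∑ x, |f x| := by
    have := mul_le_mul_of_nonneg_left hent (by positivity : 0 ≤ c / 2)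
    linarith
  calc 1 / Real.exp ((d : ℝ) / 2) * √(F.card : ℝ) = (1 / 2 ^ N) * (c * (2 ^ N * F.card)) := by
        rw [hcdef, neg_div, Real.exp_neg]
        have h2 := Real.sq_sqrt hc.le
        have h3 := Real.sqrt_pos.2 hc
        field_simp
        rw [h2]
    _ ≤ _ := by gcongr

/-! ### Complex hypercontractivity from `L^{4/3}` to `L⁴` -/

theorem two_point_imaginary_poly {r s : ℝ} (hr : 0 ≤ r) (hs : 0 ≤ s) :
    ((4 * (r ^ 6 + s ^ 6) + 4 * (r ^ 3 * s ^ 3)) / 3) ^ 2 ≤ 2 * (r ^ 4 + s ^ 4) ^ 3 := by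
  have h : 0 ≤ (r - s) ^ 4 * (r ^ 8 + 4 * r ^ 7 * s + 9 * r ^ 6 * s ^ 2 + 4 * r ^ 5 * s ^ 3 +
      r ^ 2 * s ^ 2 * (r ^ 2 - s ^ 2) ^ 2 + 4 * r ^ 3 * s ^ 5 + 9 * r ^ 2 * s ^ 6 +
      4 * r * s ^ 7 + s ^ 8) := by positivity
  linarith

theorem two_point_real_poly {r s : ℝ} (hr : 0 ≤ r) (hs : 0 ≤ s) :
    ((10 * (r ^ 6 + s ^ 6) + 16 * (r ^ 3 * s ^ 3)) / 9) ^ 2 + 4 / 9 * (r ^ 6 - s ^ 6) ^ 2 ≤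
      2 * (r ^ 4 + s ^ 4) ^ 3 := by
  have h : 0 ≤ (r - s) ^ 4 * (26 * r ^ 8 + 104 * r ^ 7 * s + 260 * r ^ 6 * s ^ 2 +
      200 * r ^ 5 * s ^ 3 + 116 * r ^ 4 * s ^ 4 + 200 * r ^ 3 * s ^ 5 + 260 * r ^ 2 * s ^ 6 +
      104 * r * s ^ 7 + 26 * s ^ 8) := by positivity
  linarith

theorem quadratic_form_nonneg {a b c : ℝ} (ha : 0 ≤ a) (hc : 0 ≤ c) (h : b ^ 2 ≤ a * c)
    (s t : ℝ) : 0 ≤ a * s ^ 2 + 2 * b * s * t + c * t ^ 2 := by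
  rcases ha.eq_or_lt with rfl | ha
  · have hb : b = 0 := by nlinarith
    subst hb
    have : 0 ≤ c * t ^ 2 := by positivity
    linarith
  · have h1 : a * (a * s ^ 2 + 2 * b * s * t + c * t ^ 2) =
        (a * s + b * t) ^ 2 + (a * c - b ^ 2) * t ^ 2 := by ring
    rw [← mul_nonneg_iff_of_pos_left ha, h1]
    have := mul_nonneg (sub_nonneg.2 h) (sq_nonneg t)
    positivity

/-- The bound on `16 (m² + n²)`, where `m ± n` are the squared moduli of the values of `T_z g` for a
function `g` on the two-point space. Here `z = x + i y` has modulus `√R` and `p`, `q`, `Q`, `D`, `η`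
are the quantities `|u|² + |v|²`, `2 Re (u v̄)`, `2 |u v|`, `|u|² - |v|²`, `2 Im (u v̄)` attached to
the values `u`, `v` of `g`. On the right the phase of `u v̄` has been eliminated. -/
theorem two_point_phase_bound {x y p q Q D η : ℝ} (hz : x ^ 2 + y ^ 2 + 2 / 3 * |x| ≤ 1 / 3)
    (hpQ : Q ≤ p) (hqQ : |q| ≤ Q) (hη : η ^ 2 = Q ^ 2 - q ^ 2) :
    ((1 + (x ^ 2 + y ^ 2)) * p + (1 - (x ^ 2 + y ^ 2)) * q) ^ 2 + 4 * (x * D - y * η) ^ 2 ≤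
      ((1 + (x ^ 2 + y ^ 2)) * p + (1 - (x ^ 2 + y ^ 2)) * Q) ^ 2 + 4 / 3 * |x| * D ^ 2 := by
  set X := |x| with hX
  have hX0 : 0 ≤ X := abs_nonneg x
  have hx2 : x ^ 2 = X ^ 2 := (sq_abs x).symm
  have hX3 : X ≤ 1 / 3 := by nlinarith [sq_nonneg y]
  have hy : y ^ 2 ≤ (1 + X) * (1 / 3 - X) := by nlinarith
  have hform := quadratic_form_nonneg (a := 2 * (1 - (x ^ 2 + y ^ 2)) - 4 * y ^ 2) (b := 4 * x * y)
    (c := 4 / 3 * X - 4 * x ^ 2) (by nlinarith) (by nlinarith) (by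
      have h1 : y ^ 2 * (1 - X) ≤ (1 + X) * (1 / 3 - X) * (1 - X) :=
        mul_le_mul_of_nonneg_right hy (by linarith)
      have h2 := mul_le_mul_of_nonneg_left h1 (by positivity : 0 ≤ 8 * X)
      rw [mul_pow, mul_pow, hx2]
      nlinarith) η D
  obtain ⟨hq1, hq2⟩ := abs_le.1 hqQ
  have hR : 0 ≤ 1 - (x ^ 2 + y ^ 2) ^ 2 := by nlinarith
  have h1 : (Q ^ 2 - q ^ 2) / 2 ≤ p * (Q - q) := by nlinarith
  have h2 := mul_le_mul_of_nonneg_left h1 hR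
  have h3 : (1 - (x ^ 2 + y ^ 2)) ^ 2 * (η ^ 2 - (Q ^ 2 - q ^ 2)) = 0 := by rw [hη]; ring
  rw [← hη] at h2
  linarith

/-- After elimination of the phase the bound is convex in `|Re z| ∈ [0, 1/3]`; the two end points
correspond to imaginary `z` and to real `z`. -/
theorem two_point_modulus_bound {R X r s : ℝ} (hR0 : 0 ≤ R) (hX : 0 ≤ X) (hX3 : X ≤ 1 / 3)
    (hz : R + 2 / 3 * X ≤ 1 / 3) (hr : 0 ≤ r) (hs : 0 ≤ s) :
    ((1 + R) * (r ^ 6 + s ^ 6) + (1 - R) * (2 * (r ^ 3 * s ^ 3))) ^ 2 +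
      4 / 3 * X * (r ^ 6 - s ^ 6) ^ 2 ≤ 2 * (r ^ 4 + s ^ 4) ^ 3 := by
  set a₀ := (4 * (r ^ 6 + s ^ 6) + 4 * (r ^ 3 * s ^ 3)) / 3 with ha₀
  set a₁ := (10 * (r ^ 6 + s ^ 6) + 16 * (r ^ 3 * s ^ 3)) / 9 with ha₁
  have h0 : a₀ ^ 2 ≤ _ := two_point_imaginary_poly hr hs
  have h1 : a₁ ^ 2 + _ ≤ _ := two_point_real_poly hr hs
  have h2 : (1 + R) * (r ^ 6 + s ^ 6) + (1 - R) * (2 * (r ^ 3 * s ^ 3)) ≤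
      (1 - 3 * X) * a₀ + 3 * X * a₁ := by
    have h3 : 0 ≤ (1 / 3 - 2 / 3 * X - R) * (r ^ 3 - s ^ 3) ^ 2 :=
      mul_nonneg (by linarith) (sq_nonneg _)
    rw [ha₀, ha₁]
    linarith
  have h4 : 0 ≤ (1 + R) * (r ^ 6 + s ^ 6) + (1 - R) * (2 * (r ^ 3 * s ^ 3)) := by
    have : 0 ≤ 1 - R := by linarith
    positivity
  have h5 := pow_le_pow_left₀ h4 h2 2
  have h6 : 0 ≤ (1 - 3 * X) * (3 * X) * (a₀ - a₁) ^ 2 :=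
    mul_nonneg (mul_nonneg (by linarith) (by linarith)) (sq_nonneg _)
  have h7 := mul_le_mul_of_nonneg_left h0 (by linarith : 0 ≤ 1 - 3 * X)
  have h8 := mul_le_mul_of_nonneg_left h1 (by linarith : 0 ≤ 3 * X)
  linarith

theorem norm_sq_noiseTwo (z u v : ℂ) (ε : ℤˣ) :
    ‖noiseTwo z u v ε‖ ^ 2 =
      ((1 + (z.re ^ 2 + z.im ^ 2)) * (‖u‖ ^ 2 + ‖v‖ ^ 2) + (1 - (z.re ^ 2 + z.im ^ 2)) *
        (2 * (u.re * v.re + u.im * v.im))) / 4 + ((ε : ℤ) : ℝ) *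
      (z.re * (‖u‖ ^ 2 - ‖v‖ ^ 2) - z.im * (2 * (u.im * v.re - u.re * v.im))) / 2 := by
  rw [Complex.sq_norm, Complex.sq_norm, Complex.sq_norm]
  rcases Int.units_eq_one_or ε with rfl | rfl <;>
    simp [noiseTwo, Complex.normSq_apply] <;> ring

/-- Hypercontractivity of `T_z` from `L^{4/3}` to `L⁴` on the two-point space, for `z` in the
intersection of the two discs of radius `2/3` centred at `±1/3`. The moduli of the values are
written as cubes, which turns the `4/3`-th powers into fourth powers. -/
theorem two_point_hypercontractive {z : ℂ} (hz : ‖z‖ ^ 2 + 2 / 3 * |z.re| ≤ 1 / 3) {u v : ℂ}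
    {r s : ℝ} (hr : 0 ≤ r) (hs : 0 ≤ s) (hu : ‖u‖ = r ^ 3) (hv : ‖v‖ = s ^ 3) :
    ‖noiseTwo z u v 1‖ ^ 4 + ‖noiseTwo z u v (-1)‖ ^ 4 ≤ 2 * ((r ^ 4 + s ^ 4) / 2) ^ 3 := by
  have hpow : ∀ t : ℝ, t ^ 4 = (t ^ 2) ^ 2 := fun t => by ring
  have hce : (u.re * v.re + u.im * v.im) ^ 2 + (u.im * v.re - u.re * v.im) ^ 2 =
      (r ^ 3 * s ^ 3) ^ 2 := by
    rw [mul_pow, ← hu, ← hv, Complex.sq_norm, Complex.sq_norm, Complex.normSq_apply,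
      Complex.normSq_apply]
    ring
  rw [hpow, hpow, norm_sq_noiseTwo, norm_sq_noiseTwo, hu, hv]
  rw [Complex.sq_norm, Complex.normSq_apply, ← sq, ← sq] at hz
  set c := u.re * v.re + u.im * v.im
  set e := u.im * v.re - u.re * v.im
  have h3 : 0 ≤ r ^ 3 * s ^ 3 := by positivity
  have h1 := two_point_phase_bound (p := r ^ 6 + s ^ 6) (q := 2 * c) (Q := 2 * (r ^ 3 * s ^ 3))
    (D := r ^ 6 - s ^ 6) (η := 2 * e) hz (by nlinarith [sq_nonneg (r ^ 3 - s ^ 3)])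
    (abs_le_of_sq_le_sq (by nlinarith [sq_nonneg e]) (by positivity)) (by linarith)
  have hX3 : |z.re| ≤ 1 / 3 := by nlinarith [sq_nonneg z.im, sq_abs z.re, abs_nonneg z.re]
  have h2 := two_point_modulus_bound (by positivity) (abs_nonneg z.re) hX3 hz hr hs
  simp only [Units.val_one, Int.cast_one, one_mul, Units.val_neg, Int.cast_neg, neg_mul]
  linarith

/-- Minkowski's inequality in `L³`, for norms given by upper bounds `α`, `β` and a total mass `C`. -/
theorem sum_add_cube_le {ι : Type*} (t : Finset ι) {p q : ι → ℝ} {α β C : ℝ}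
    (hp : ∀ i ∈ t, 0 ≤ p i) (hq : ∀ i ∈ t, 0 ≤ q i) (hα : 0 ≤ α) (hβ : 0 ≤ β)
    (hpα : ∑ i ∈ t, p i ^ 3 ≤ C * α ^ 3) (hqβ : ∑ i ∈ t, q i ^ 3 ≤ C * β ^ 3) :
    ∑ i ∈ t, (p i + q i) ^ 3 ≤ C * (α + β) ^ 3 := by
  have hzero : ∀ {f : ι → ℝ}, (∀ i ∈ t, 0 ≤ f i) → ∑ i ∈ t, f i ^ 3 ≤ 0 → ∀ i ∈ t, f i = 0 := by
    intro f hf h i hi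
    have h1 := (Finset.sum_eq_zero_iff_of_nonneg fun i hi => pow_nonneg (hf i hi) 3).1
      (le_antisymm h (Finset.sum_nonneg fun i hi => pow_nonneg (hf i hi) 3)) i hi
    exact pow_eq_zero_iff (by norm_num) |>.1 h1
  rcases hα.eq_or_lt with rfl | hα
  · rw [zero_add, Finset.sum_congr rfl fun i hi => by
      rw [hzero hp (by simpa using hpα) i hi, zero_add]]
    exact hqβ
  rcases hβ.eq_or_lt with rfl | hβ
  · rw [add_zero, Finset.sum_congr rfl fun i hi => by
      rw [hzero hq (by simpa using hqβ) i hi, add_zero]]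
    exact hpα
  have hpt : ∀ i ∈ t, (p i + q i) ^ 3 ≤
      (α + β) ^ 2 / α ^ 2 * p i ^ 3 + (α + β) ^ 2 / β ^ 2 * q i ^ 3 := by
    intro i hi
    have h := (convexOn_pow (𝕜 := ℝ) 3).2
      (show p i / α ∈ Set.Ici 0 from div_nonneg (hp i hi) hα.le)
      (show q i / β ∈ Set.Ici 0 from div_nonneg (hq i hi) hβ.le)
      (show 0 ≤ α / (α + β) by positivity) (show 0 ≤ β / (α + β) by positivity) (by field_simp)
    simp only [smul_eq_mul] at h
    have h1 : α / (α + β) * (p i / α) + β / (α + β) * (q i / β) = (p i + q i) / (α + β) := by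
      field_simp
    rw [h1, div_pow, div_le_iff₀ (by positivity)] at h
    refine h.trans_eq ?_
    field_simp
  refine (Finset.sum_le_sum hpt).trans ?_
  rw [Finset.sum_add_distrib, ← Finset.mul_sum, ← Finset.mul_sum]
  calc _ ≤ (α + β) ^ 2 / α ^ 2 * (C * α ^ 3) + (α + β) ^ 2 / β ^ 2 * (C * β ^ 3) := by gcongr
    _ = C * (α + β) ^ 3 := by
      field_simp

theorem exists_nonneg_cube_eq {t : ℝ} (ht : 0 ≤ t) : ∃ a : ℝ, 0 ≤ a ∧ t = a ^ 3 :=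
  ⟨t ^ ((3 : ℝ)⁻¹), by positivity, by
    rw [← Real.rpow_natCast, ← Real.rpow_mul ht]
    norm_num⟩

/-- Hypercontractivity of `T_z` from `L^{4/3}` to `L⁴` on the cube. It tensorizes by Minkowski's
inequality in `L³`. -/
theorem hypercontractive {z : ℂ} (hz : ‖z‖ ^ 2 + 2 / 3 * |z.re| ≤ 1 / 3) :
    ∀ {N : ℕ} (g : Cube N → ℂ) (κ : Cube N → ℝ), (∀ x, 0 ≤ κ x) → (∀ x, ‖g x‖ = κ x ^ 3) →
      ∑ x, ‖noiseOp z g x‖ ^ 4 ≤ 2 ^ N * ((∑ x, κ x ^ 4) / 2 ^ N) ^ 3 := by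
  intro N
  induction N with
  | zero =>
    intro g κ _ hg
    simp [noiseOp, hg]
    exact le_of_eq (by ring)
  | succ n ih =>
    intro g κ hκ hg
    set u : Cube n → ℂ := fun x => g (Fin.cons 1 x) with hu
    set v : Cube n → ℂ := fun x => g (Fin.cons (-1) x) with hv
    choose a ha0 ha using fun x => exists_nonneg_cube_eq (norm_nonneg (noiseOp z u x))
    choose b hb0 hb using fun x => exists_nonneg_cube_eq (norm_nonneg (noiseOp z v x))
    have h1 := ih u (fun x => κ (Fin.cons 1 x)) (fun x => hκ _) fun x => hg _
    have h2 := ih v (fun x => κ (Fin.cons (-1) x)) (fun x => hκ _) fun x => hg _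
    simp_rw [ha, ← pow_mul] at h1
    simp_rw [hb, ← pow_mul] at h2
    set α := (∑ x : Cube n, κ (Fin.cons 1 x) ^ 4) / 2 ^ n with hα
    set β := (∑ x : Cube n, κ (Fin.cons (-1) x) ^ 4) / 2 ^ n with hβ
    have h3 := sum_add_cube_le Finset.univ (p := fun x => a x ^ 4) (q := fun x => b x ^ 4)
      (α := α) (β := β) (C := 2 ^ n) (fun x _ => by positivity) (fun x _ => by positivity)
      (by positivity) (by positivity) (by simpa only [← pow_mul] using h1)
      (by simpa only [← pow_mul] using h2)
    have h4 : (∑ x, κ x ^ 4) / 2 ^ (n + 1) = (α + β) / 2 := by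
      rw [sum_cube_succ, sum_units, hα, hβ, pow_succ]
      field_simp
    rw [h4, sum_cube_succ, sum_units, ← Finset.sum_add_distrib]
    simp_rw [noiseOp_cons]
    calc _ ≤ ∑ x : Cube n, 2 * ((a x ^ 4 + b x ^ 4) / 2) ^ 3 :=
          Finset.sum_le_sum fun x _ => two_point_hypercontractive hz (ha0 x) (hb0 x) (ha x) (hb x)
      _ = 1 / 4 * ∑ x : Cube n, (a x ^ 4 + b x ^ 4) ^ 3 := by
          rw [Finset.mul_sum]
          exact Finset.sum_congr rfl fun x _ => by ring
      _ ≤ 1 / 4 * (2 ^ n * (α + β) ^ 3) := by gcongr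
      _ = _ := by ring

/-! ### Families of sets of bounded size -/

/-- The ellipse with semi-axes `37/125` and `63/125`, the image of the unit circle under
`v ↦ (2/5) v⁻¹ - (13/125) v`, lies in the domain of hypercontractivity. -/
theorem ellipse_subset {v : ℂ} (hv : ‖v‖ = 1) :
    ‖2 / 5 * v⁻¹ - 13 / 125 * v‖ ^ 2 + 2 / 3 * |(2 / 5 * v⁻¹ - 13 / 125 * v).re| ≤ 1 / 3 := by
  have h1 : v.re ^ 2 + v.im ^ 2 = 1 := by
    rw [sq, sq, ← Complex.normSq_apply, ← Complex.sq_norm, hv, one_pow]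
  have hre : (2 / 5 * v⁻¹ - 13 / 125 * v).re = 37 / 125 * v.re := by
    rw [Complex.inv_eq_conj hv]
    simp
    ring
  have him : (2 / 5 * v⁻¹ - 13 / 125 * v).im = -(63 / 125) * v.im := by
    rw [Complex.inv_eq_conj hv]
    simp
    ring
  rw [Complex.sq_norm, Complex.normSq_apply, hre, him, abs_mul, abs_of_pos (by norm_num)]
  nlinarith [sq_abs v.re, sq_nonneg (|v.re| - 3 / 5)]

theorem norm_walsh_polynomial_eq {F : Finset (Finset (Fin N))} {d : ℕ} (hF : ∀ S ∈ F, S.card ≤ d)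
    {v : ℂ} (hv : ‖v‖ = 1) (x : Cube N) :
    ‖∑ S ∈ F, v ^ (d - S.card) * (2 / 5 - 13 / 125 * v ^ 2) ^ S.card * walsh S x‖ =
      ‖noiseOp (2 / 5 * v⁻¹ - 13 / 125 * v)
        (fun y => ((∑ S ∈ F, walsh S y : ℝ) : ℂ)) x‖ := by
  have hv0 : v ≠ 0 := norm_ne_zero_iff.1 (by rw [hv]; exact one_ne_zero)
  have h : ∑ S ∈ F, v ^ (d - S.card) * (2 / 5 - 13 / 125 * v ^ 2) ^ S.card * walsh S x =
      v ^ d * ∑ S ∈ F, (2 / 5 * v⁻¹ - 13 / 125 * v) ^ S.card * walsh S x := by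
    rw [Finset.mul_sum]
    refine Finset.sum_congr rfl fun S hS => ?_
    have h1 : (2 / 5 - 13 / 125 * v ^ 2 : ℂ) = v * (2 / 5 * v⁻¹ - 13 / 125 * v) := by
      field_simp
    rw [h1, mul_pow, ← mul_assoc, ← mul_assoc, ← pow_add, Nat.sub_add_cancel (hF S hS)]
  rw [h, norm_mul, norm_pow, hv, one_pow, one_mul, noiseOp_walsh_family]

theorem young_cube_mul {θ a b : ℝ} (hθ : 0 < θ) (ha : 0 ≤ a) (hb : 0 ≤ b) :
    a ^ 3 * b ≤ 3 / 4 * θ * a ^ 4 + 1 / 4 * (1 / θ ^ 3) * b ^ 4 := by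
  obtain ⟨c, rfl⟩ : ∃ c, b = θ * c := ⟨b / θ, by field_simp⟩
  have hc : 0 ≤ c := by
    by_contra! h
    nlinarith
  have h1 : 0 ≤ θ * ((a - c) ^ 2 * (3 * a ^ 2 + 2 * a * c + c ^ 2)) := by positivity
  have h2 : 1 / 4 * (1 / θ ^ 3) * (θ * c) ^ 4 = 1 / 4 * θ * c ^ 4 := by field_simp
  rw [h2]
  linarith

/-- For polynomials of degree at most `d` the hypercontractive bound on the ellipse propagates to
`z = 1` at the expense of a factor `(13/5)^d`. This is the maximum principle for
`v ^ d T_z f`, `z = (2/5) v⁻¹ - (13/125) v`, on the unit disc; the point `v = 5/13` gives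
`z = 1`. -/
theorem sum_pow_four_walsh_family_le {F : Finset (Finset (Fin N))} {d : ℕ}
    (hF : ∀ S ∈ F, S.card ≤ d) (κ : Cube N → ℝ) (hκ : ∀ x, 0 ≤ κ x)
    (hfκ : ∀ x, |∑ S ∈ F, walsh S x| = κ x ^ 3) :
    ((5 / 13 : ℝ) ^ d) ^ 4 * ∑ x, |∑ S ∈ F, walsh S x| ^ 4 ≤
      2 ^ N * ((∑ x, κ x ^ 4) / 2 ^ N) ^ 3 := by
  set f : Cube N → ℝ := fun x => ∑ S ∈ F, walsh S x with hf
  set θ : ℝ := (5 / 13) ^ d with hθ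
  set B : ℝ := 2 ^ N * ((∑ x, κ x ^ 4) / 2 ^ N) ^ 3 with hB
  have hθ0 : 0 < θ := by positivity
  set K : ℂ → Cube N → ℂ := fun v x =>
    ∑ S ∈ F, v ^ (d - S.card) * (2 / 5 - 13 / 125 * v ^ 2) ^ S.card * walsh S x with hK
  -- the polynomial is tested against `f³`, which is extremal at `v = 5/13`
  set h : ℂ → ℂ := fun v => ∑ x, (f x : ℂ) ^ 3 * K v x with hh
  have hdiff : Differentiable ℂ h := by
    simp only [hh, hK]
    fun_prop
  have hval : h (5 / 13) = ((θ * ∑ x, |f x| ^ 4 : ℝ) : ℂ) := by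
    have h1 : ∀ x, K (5 / 13) x = (θ * f x : ℝ) := fun x => by
      simp only [hK, hf, hθ]
      push_cast
      rw [Finset.mul_sum]
      refine Finset.sum_congr rfl fun S hS => ?_
      rw [show (2 / 5 - 13 / 125 * (5 / 13) ^ 2 : ℂ) = 5 / 13 by norm_num, ← pow_add,
        Nat.sub_add_cancel (hF S hS)]
    simp only [hh, h1]
    push_cast
    rw [Finset.mul_sum]
    refine Finset.sum_congr rfl fun x _ => ?_
    have h2 : |f x| ^ 4 = f x ^ 4 := (by decide : Even 4).pow_abs (f x)
    rw [← Complex.ofReal_pow |f x|, h2]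
    push_cast
    ring
  have hcircle : ∀ v ∈ frontier (Metric.ball (0 : ℂ) 1),
      ‖h v‖ ≤ 3 / 4 * θ * ∑ x, |f x| ^ 4 + 1 / 4 * (1 / θ ^ 3) * B := by
    intro v hv
    rw [frontier_ball _ one_ne_zero, mem_sphere_zero_iff_norm] at hv
    have h1 : ∑ x, ‖K v x‖ ^ 4 ≤ B := by
      simp only [hK, norm_walsh_polynomial_eq hF hv]
      exact hypercontractive (ellipse_subset hv) _ κ hκ fun x => by
        rw [Complex.norm_real, Real.norm_eq_abs, hfκ]
    calc ‖h v‖ ≤ ∑ x, |f x| ^ 3 * ‖K v x‖ := by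
          refine (norm_sum_le _ _).trans_eq (Finset.sum_congr rfl fun x _ => ?_)
          rw [norm_mul, norm_pow, Complex.norm_real, Real.norm_eq_abs]
      _ ≤ ∑ x, (3 / 4 * θ * |f x| ^ 4 + 1 / 4 * (1 / θ ^ 3) * ‖K v x‖ ^ 4) :=
          Finset.sum_le_sum fun x _ => young_cube_mul hθ0 (abs_nonneg _) (norm_nonneg _)
      _ ≤ _ := by
          rw [Finset.sum_add_distrib, ← Finset.mul_sum, ← Finset.mul_sum]
          gcongr
  have hmax := Complex.norm_le_of_forall_mem_frontier_norm_le Metric.isBounded_ball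
    hdiff.diffContOnCl hcircle (z := 5 / 13) (by
      rw [closure_ball _ one_ne_zero, mem_closedBall_zero_iff]
      norm_num)
  rw [hval, Complex.norm_real, Real.norm_eq_abs, abs_of_nonneg (by positivity)] at hmax
  have h1 : θ * ∑ x, |f x| ^ 4 ≤ 1 / θ ^ 3 * B := by linarith
  have h2 := mul_le_mul_of_nonneg_left h1 (by positivity : 0 ≤ θ ^ 3)
  have h3 : θ ^ 3 * (1 / θ ^ 3 * B) = B := by field_simp
  rw [h3] at h2
  linarith

theorem sqrt_card_le_mean_abs_of_card_le {F : Finset (Finset (Fin N))} {d : ℕ}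
    (hF : ∀ S ∈ F, S.card ≤ d) :
    (5 / 13 : ℝ) ^ d * √(F.card : ℝ) ≤ (1 / 2 ^ N) * ∑ x, |∑ S ∈ F, walsh S x| := by
  rcases F.eq_empty_or_nonempty with rfl | hne
  · simp
  have hc : (0 : ℝ) < F.card := by exact_mod_cast hne.card_pos
  choose κ hκ hfκ using fun x : Cube N => exists_nonneg_cube_eq (abs_nonneg (∑ S ∈ F, walsh S x))
  have hyp := sum_pow_four_walsh_family_le hF κ hκ hfκ
  have hsq := sum_walsh_family_sq F
  set θ : ℝ := (5 / 13) ^ d with hθ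
  have hθ0 : 0 < θ := by positivity
  simp_rw [← sq_abs (∑ S ∈ F, walsh S _)] at hsq
  simp_rw [hfκ, ← pow_mul] at hyp hsq ⊢
  norm_num only at hyp hsq ⊢
  -- `m₁`, `b`, `m₄` are the means of `|f|`, `|f|^{4/3}` and `|f|⁴`
  set m₁ := (1 / 2 ^ N : ℝ) * ∑ x, κ x ^ 3 with hm₁
  set b := (1 / 2 ^ N : ℝ) * ∑ x, κ x ^ 4 with hb
  set m₄ := (1 / 2 ^ N : ℝ) * ∑ x, κ x ^ 12 with hm₄
  have hpos : 0 < ∑ x, κ x ^ 6 := by rw [hsq]; positivity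
  obtain ⟨x₀, -, hx₀⟩ := Finset.exists_lt_of_sum_lt (f := fun _ => (0 : ℝ)) (by simpa using hpos)
  have hκ₀ : 0 < κ x₀ := (hκ x₀).lt_of_ne fun h => by simp [← h] at hx₀
  have hsum_pos : ∀ n : ℕ, 0 < (1 / 2 ^ N : ℝ) * ∑ x, κ x ^ n := fun n =>
    mul_pos (by positivity) (Finset.sum_pos' (fun x _ => pow_nonneg (hκ x) n)
      ⟨x₀, Finset.mem_univ _, pow_pos hκ₀ n⟩)
  have hm₁0 : 0 < m₁ := hsum_pos 3
  have hm₄0 : 0 < m₄ := hsum_pos 12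
  have hb0 : 0 < b := hsum_pos 4
  have hyp' : θ ^ 4 * m₄ ≤ b ^ 3 := by
    have h1 := mul_le_mul_of_nonneg_left hyp (by positivity : (0 : ℝ) ≤ 1 / 2 ^ N)
    have h2 : b = (∑ x, κ x ^ 4) / 2 ^ N := by rw [hb]; ring
    have h3 : (1 / 2 ^ N : ℝ) * (2 ^ N * ((∑ x, κ x ^ 4) / 2 ^ N) ^ 3) = b ^ 3 := by
      rw [h2]
      field_simp
    rw [h3] at h1
    linarith
  obtain ⟨s, hs0, hs⟩ : ∃ s : ℝ, 0 < s ∧ s ^ 9 * m₁ = m₄ := by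
    refine ⟨(m₄ / m₁) ^ ((9 : ℝ)⁻¹), by positivity, ?_⟩
    rw [← Real.rpow_natCast, ← Real.rpow_mul (by positivity)]
    norm_num
    field_simp
  -- the two interpolation inequalities, from weighted means of powers of `κ` and `s`
  have hb_le : b ≤ s * m₁ := by
    have h1 : ∀ x, 9 * s ^ 8 * κ x ^ 4 ≤ 8 * s ^ 9 * κ x ^ 3 + κ x ^ 12 := fun x => by
      have h2 : 0 ≤ κ x ^ 3 * ((κ x - s) ^ 2 * (κ x ^ 7 + 2 * κ x ^ 6 * s + 3 * κ x ^ 5 * s ^ 2 +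
          4 * κ x ^ 4 * s ^ 3 + 5 * κ x ^ 3 * s ^ 4 + 6 * κ x ^ 2 * s ^ 5 + 7 * κ x * s ^ 6 +
          8 * s ^ 7)) := by
        have := hκ x
        positivity
      linarith
    have h2 := mul_le_mul_of_nonneg_left (Finset.sum_le_sum fun x (_ : x ∈ Finset.univ) => h1 x)
      (by positivity : (0 : ℝ) ≤ 1 / 2 ^ N)
    rw [Finset.sum_add_distrib, ← Finset.mul_sum, ← Finset.mul_sum] at h2
    have h3 : 9 * s ^ 8 * b ≤ 9 * s ^ 8 * (s * m₁) := by
      linarith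
    exact le_of_mul_le_mul_left h3 (by positivity)
  have hm₂_le : (F.card : ℝ) ≤ s ^ 3 * m₁ := by
    have h1 : ∀ x, 3 * s ^ 6 * κ x ^ 6 ≤ 2 * s ^ 9 * κ x ^ 3 + κ x ^ 12 := fun x => by
      have h2 : 0 ≤ κ x ^ 3 * ((κ x ^ 3 - s ^ 3) ^ 2 * (κ x ^ 3 + 2 * s ^ 3)) := by
        have := hκ x
        positivity
      linarith
    have h2 := mul_le_mul_of_nonneg_left (Finset.sum_le_sum fun x (_ : x ∈ Finset.univ) => h1 x)
      (by positivity : (0 : ℝ) ≤ 1 / 2 ^ N)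
    rw [Finset.sum_add_distrib, ← Finset.mul_sum, ← Finset.mul_sum, hsq] at h2
    have h3 : (1 / 2 ^ N : ℝ) * (3 * s ^ 6 * (2 ^ N * F.card)) = 3 * s ^ 6 * F.card := by
      field_simp
    have h4 : 3 * s ^ 6 * F.card ≤ 3 * s ^ 6 * (s ^ 3 * m₁) := by
      linarith
    exact le_of_mul_le_mul_left h4 (by positivity)
  have h1 : θ ^ 2 * s ^ 3 ≤ m₁ := by
    have h2 := hyp'.trans (pow_le_pow_left₀ hb0.le hb_le 3)
    rw [← hs] at h2
    have h3 : (s ^ 3 * m₁) * (θ ^ 2 * s ^ 3) ^ 2 ≤ (s ^ 3 * m₁) * m₁ ^ 2 := by linarith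
    exact le_of_sq_le_sq (le_of_mul_le_mul_left h3 (by positivity)) hm₁0.le
  refine (le_abs_self _).trans (abs_le_of_sq_le_sq ?_ hm₁0.le)
  rw [mul_pow, Real.sq_sqrt hc.le]
  nlinarith [mul_le_mul_of_nonneg_left hm₂_le (sq_nonneg θ), mul_le_mul_of_nonneg_right h1 hm₁0.le]

end BooleanProj

end

theorem corollary3p2 (N d : ℕ) (F : Finset (Finset (Fin N))) :
    ((∀ S ∈ F, S.card = d) →
      ENNReal.ofReal (1 / Real.exp ((d : ℝ) / 2) * Real.sqrt (F.card : ℝ)) ≤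
          BooleanProj.projConst.{w, 0} (BooleanProj.walshSpace F) ∧
        BooleanProj.projConst.{w, 0} (BooleanProj.walshSpace F) ≤
          ENNReal.ofReal (Real.sqrt (F.card : ℝ))) ∧
    ((∀ S ∈ F, S.card ≤ d) →
      ENNReal.ofReal (1 / (2.69076 : ℝ) ^ d * Real.sqrt (F.card : ℝ)) ≤
          BooleanProj.projConst.{w, 0} (BooleanProj.walshSpace F) ∧
        BooleanProj.projConst.{w, 0} (BooleanProj.walshSpace F) ≤
          ENNReal.ofReal (Real.sqrt (F.card : ℝ))) := by
  refine ⟨fun hF => ⟨?_, BooleanProj.projConst_walshSpace_le F⟩,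
    fun hF => ⟨?_, BooleanProj.projConst_walshSpace_le F⟩⟩
  · exact (ENNReal.ofReal_le_ofReal (BooleanProj.sqrt_card_le_mean_abs_of_card_eq hF)).trans
      (BooleanProj.mean_abs_walsh_family_le_projConst F)
  · refine (ENNReal.ofReal_le_ofReal ?_).trans (BooleanProj.mean_abs_walsh_family_le_projConst F)
    refine le_trans ?_ (BooleanProj.sqrt_card_le_mean_abs_of_card_le hF)
    rw [← one_div_pow]
    gcongr ?_ ^ d * _
    norm_num
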